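/- Conventions. A lattice simplex of dimension $d$ is the convex hull $\Delta\subset\mathbb{R}^d$ of $d+1$ affinely independent points $v_1,\dots,v_{d+1}\in\mathbb{Z}^d$. Sets $P,P'\subset\mathbb{R}^d$ are unimodularly equivalent if $P'=f(P)+u$ for some $f\in\mathrm{GL}_d(\mathbb{Z})$ and $u\in\mathbb{Z}^d$. The degree of $\Delta$ is the degree of its $h^*$-polynomial $h^*_\Delta$, defined by $\sum_{n\ge 0}|n\Delta\cap\mathbb{Z}^d|\,t^n=h^*_\Delta(t)/(1-t)^{d+1}$. We say that $\Delta$ is a lattice pyramid if it is unimodularly equivalent to $\mathrm{conv}\big((P\times\{0\})\cup\{(0,\dots,0,1)\}\big)\subset\mathbb{R}^{d}$ for some lattice polytope $P\subset\mathbb{R}^{d-1}$. For a lattice simplex with ordered vertices put $$\Lambda_\Delta=\Big\{x\in(\mathbb{R}/\mathbb{Z})^{d+1}:\ \sum_i x_iv_i\in\mathbb{Z}^d,\ \sum_i x_i\in\mathbb{Z}\Big\}.$$ For $k\ge 2$ let $A(k)$ be the $k\times(2^k-1)$ matrix over $\mathbb{F}_2$ whose columns are all the nonzero vectors of $\mathbb{F}_2^k$;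 its row space is the $k$-dimensional binary simplex code, and $B(k)\subset(\mathbb{R}/\mathbb{Z})^{2^k-1}$ is the image of this code under $(a_j)_j\mapsto(a_j/2)_j$. Let $\Delta(k)$ be a lattice simplex of dimension $2^k-2$ with $\Lambda_{\Delta(k)}=B(k)$. Explicitly, take as coordinates of $\mathbb{R}^{2^k-2}$ the vectors $c\in\mathbb{F}_2^k$ different from $0$ and from the all-ones vector, with coordinate vectors $e_c$; then $\Delta(k)$ is the convex hull of the origin, of the $e_c$ for which $c$ is not a unit vector, and, for each $l=1,\dots,k$, of the point $2e_{u_l}-\sum_{c}e_{c}$, where $u_l$ is the $l$-th unit vector and the sum is over the $c$ with $c_l=1$ that are not unit vectors. Theorem 1.2. Let $s$ be a positive integer and let $\Delta$ be a lattice simplex of dimension $4s-2$ and degree $s$ that is not a lattice pyramid. Then $s=2^r$ for some integer $r\ge 0$. Moreover, $\Lambda_\Delta=B(r+2)$ for a suitable ordering of the vertices of $\Delta$, and $\Delta$ is unimodularly equivalent to $\Delta(r+2)$. In particular, $\Delta$ is uniquely determined by $r$ up to unimodular equivalence. -/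

import Mathlib

open scoped Pointwise PowerSeries

/-! ### Lattice polytopes in `ℝ^ι` with lattice `ℤ^ι`, where `ι` is a finite index type -/

/-- The integer vector `z`, regarded as a point of real space. -/
def latticePoint {ι : Type*} (z : ι → ℤ) : ι → ℝ := fun i => (z i : ℝ)

/-- A (nonempty) lattice polytope: the convex hull of finitely many lattice points. -/
def IsLatticePolytope {ι : Type*} (P : Set (ι → ℝ)) : Prop :=
  ∃ V : Finset (ι → ℤ), V.Nonempty ∧ P = convexHull ℝ (latticePoint '' (V : Set (ι → ℤ)))

/-- `P` is a full-dimensional lattice simplex in `ℝ^ι`, with vertices `v j`, `j ∈ J`: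
there are `dim + 1` of them, they are affinely independent, and `P` is their convex hull. -/
structure IsLatticeSimplexWithVertices {ι J : Type*} [Fintype ι] [Fintype J]
    (v : J → ι → ℤ) (P : Set (ι → ℝ)) : Prop where
  card_eq : Fintype.card J = Fintype.card ι + 1
  affineIndependent : AffineIndependent ℝ (fun j => latticePoint (v j))
  eq_convexHull : P = convexHull ℝ (Set.range fun j => latticePoint (v j))

/-- A lattice simplex of dimension `|ι|` in `ℝ^ι`. -/
def IsLatticeSimplex {ι : Type*} [Fintype ι] (P : Set (ι → ℝ)) : Prop :=
  ∃ v : Fin (Fintype.card ι + 1) → ι → ℤ, IsLatticeSimplexWithVertices v P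

/-- Unimodular equivalence: `Q = f(P) + u` with `u` a lattice vector and `f` a linear
isomorphism of the lattices, given by an integer matrix `A` with an integer inverse `A'`.
When `ι = κ = Fin d` this says that `f ∈ GL_d(ℤ)`. -/
def UnimodularlyEquivalent {ι κ : Type*} [Fintype ι] [Fintype κ] [DecidableEq ι] [DecidableEq κ]
    (P : Set (ι → ℝ)) (Q : Set (κ → ℝ)) : Prop :=
  ∃ (A : Matrix κ ι ℤ) (A' : Matrix ι κ ℤ) (u : κ → ℤ), A * A' = 1 ∧ A' * A = 1 ∧
    Q = (fun x => (A.map (Int.cast : ℤ → ℝ)).mulVec x + latticePoint u) '' P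

/-- The pyramid over `P ⊆ ℝ^e`: the convex hull in `ℝ^(e+1)` of `P × {0}` and `(0, …, 0, 1)`. -/
def latticePyr {e : ℕ} (P : Set (Fin e → ℝ)) : Set (Fin (e + 1) → ℝ) :=
  convexHull ℝ ((fun a => (Fin.snoc a 0 : Fin (e + 1) → ℝ)) '' P ∪
    {(Fin.snoc (0 : Fin e → ℝ) 1 : Fin (e + 1) → ℝ)})

/-- `Q` is, up to unimodular equivalence, a lattice pyramid over some lattice polytope. -/
def IsLatticePyramid {ι : Type*} [Fintype ι] [DecidableEq ι] (Q : Set (ι → ℝ)) : Prop :=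
  ∃ (e : ℕ) (P : Set (Fin e → ℝ)), IsLatticePolytope P ∧ UnimodularlyEquivalent Q (latticePyr P)

/-- The number `|nP ∩ ℤ^ι|` of lattice points in the `n`-th dilate of `P`. -/
noncomputable def ehrhartCount {ι : Type*} (P : Set (ι → ℝ)) (n : ℕ) : ℕ :=
  Set.ncard {z : ι → ℤ | latticePoint z ∈ (n : ℝ) • P}

/-- The Ehrhart series `∑ₙ |nP ∩ ℤ^ι| tⁿ`. -/
noncomputable def ehrhartSeries {ι : Type*} (P : Set (ι → ℝ)) : ℤ⟦X⟧ :=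
  PowerSeries.mk fun n => (ehrhartCount P n : ℤ)

/-- `h` is the `h^*`-polynomial of the full-dimensional lattice polytope `P ⊆ ℝ^ι`: the Ehrhart
series is `h / (1 - t)^(d+1)`, `d = |ι|`. There is at most one such polynomial. -/
def IsHStarPolynomial {ι : Type*} [Fintype ι] (P : Set (ι → ℝ)) (h : Polynomial ℤ) : Prop :=
  (h : ℤ⟦X⟧) = ehrhartSeries P * (1 - PowerSeries.X) ^ (Fintype.card ι + 1)

/-- `P` has degree `s`, i.e. its `h^*`-polynomial has degree `s`. -/
def HasHStarDegree {ι : Type*} [Fintype ι] (P : Set (ι → ℝ)) (s : ℕ) : Prop :=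
  ∃ h : Polynomial ℤ, IsHStarPolynomial P h ∧ h.degree = s

/-- The group `Λ` of a simplex with vertices `v j`: all `x ∈ (ℝ/ℤ)^J` with `∑ x_j v_j ∈ ℤ^ι` and
`∑ x_j ∈ ℤ`. Both conditions are equations in `ℝ/ℤ`. -/
def simplexGroup {ι J : Type*} [Fintype J] (v : J → ι → ℤ) : AddSubgroup (J → UnitAddCircle) where
  carrier := {x | (∀ i, ∑ j, v j i • x j = 0) ∧ ∑ j, x j = 0}
  zero_mem' := by simp
  add_mem' := by
    rintro x y ⟨hx, hx'⟩ ⟨hy, hy'⟩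
    refine ⟨fun i => ?_, ?_⟩
    · simp [smul_add, Finset.sum_add_distrib, hx i, hy i]
    · simp [Finset.sum_add_distrib, hx', hy']
  neg_mem' := by
    rintro x ⟨hx, hx'⟩
    refine ⟨fun i => ?_, ?_⟩
    · simp [hx i]
    · simp [hx']

/-! ### Binary simplex codes and the associated simplices -/

/-- The points of the projective space `ℙ^(k-1)` over `𝔽₂`: the nonzero vectors of `𝔽₂^k`. -/
abbrev BinaryPoint (k : ℕ) : Type := {c : Fin k → ZMod 2 // c ≠ 0}

/-- The `k × (2^k - 1)` matrix whose columns are the points of `ℙ^(k-1)` over `𝔽₂`. -/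
def simplexCodeMatrix (k : ℕ) : Matrix (Fin k) (BinaryPoint k) (ZMod 2) :=
  Matrix.of fun l c => c.1 l

/-- The `k`-dimensional binary simplex code: the row space of `simplexCodeMatrix k`. -/
def binarySimplexCode (k : ℕ) : Submodule (ZMod 2) (BinaryPoint k → ZMod 2) :=
  Submodule.span (ZMod 2) (Set.range (simplexCodeMatrix k).row)

/-- The subgroup of `(ℝ/ℤ)^J` of a binary code: the image of the code under
`(a_j) ↦ (a_j / 2)`. -/
noncomputable def codeGroup {J : Type*} (C : Submodule (ZMod 2) (J → ZMod 2)) :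
    AddSubgroup (J → UnitAddCircle) :=
  C.toAddSubgroup.map ((ZMod.toAddCircle (N := 2)).compLeft J)

/-- `P` is a lattice simplex whose group `Λ`, for a suitable labelling of its vertices, is the
group of the `k`-dimensional binary simplex code. -/
def ArisesFromSimplexCode {ι : Type*} [Fintype ι] (k : ℕ) (P : Set (ι → ℝ)) : Prop :=
  ∃ v : BinaryPoint k → ι → ℤ, IsLatticeSimplexWithVertices v P ∧
    simplexGroup v = codeGroup (binarySimplexCode k)

/-- Coordinate labels for the simplex `Δ(k)`: the vectors of `𝔽₂^k` other than `0` and the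
all-ones vector; there are `2^k - 2` of them. -/
abbrev CodeSimplexCoord (k : ℕ) : Type := {c : Fin k → ZMod 2 // c ≠ 0 ∧ c ≠ 1}

/-- The vertices of `Δ(k)`, labelled by the points `c` of `ℙ^(k-1)`. With `e_c` the coordinate
vectors, the vertex of the all-ones vector is the origin, the vertex of any other `c` that is not
a unit vector is `e_c`, and the vertex of the `l`-th unit vector `c` is `2 e_c - ∑ e_{c'}`, over
the coordinates `c'` with `c'_l = 1` that are not unit vectors. -/
def codeSimplexVertex (k : ℕ) (c : BinaryPoint k) (c' : CodeSimplexCoord k) : ℤ :=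
  if c.1 = c'.1 then (if ∃ l, c.1 = Pi.single l 1 then 2 else 1)
  else if (∃ l, c.1 = Pi.single l 1 ∧ c'.1 l = 1) ∧ ¬ ∃ l, c'.1 = Pi.single l 1 then -1
  else 0

/-- The lattice simplex `Δ(k)`, of dimension `2^k - 2`, of the `k`-dimensional binary simplex
code, for `k ≥ 2` (see `codeSimplex_spec`). -/
def codeSimplex (k : ℕ) : Set (CodeSimplexCoord k → ℝ) :=
  convexHull ℝ (Set.range fun c => latticePoint (codeSimplexVertex k c))

/-- The `l`-th unit vector, as a point of `ℙ^(k-1)`. -/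
def unitPoint {k : ℕ} (l : Fin k) : BinaryPoint k :=
  ⟨Pi.single l 1, by simp⟩

theorem zmod_two_eq_one {a : ZMod 2} (h : a ≠ 0) : a = 1 := by
  revert a; decide

theorem single_ne_one {k : ℕ} (hk : 2 ≤ k) (l : Fin k) :
    (Pi.single l 1 : Fin k → ZMod 2) ≠ 1 := by
  intro h
  have : Nontrivial (Fin k) := Fin.nontrivial_iff_two_le.mpr hk
  obtain ⟨m, hm⟩ := exists_ne l
  have := congrFun h m
  simp [hm] at this

theorem sum_codeSimplexVertex_unit {k : ℕ} {M : Type*} [AddCommGroup M] (x : BinaryPoint k → M)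
    (c' : CodeSimplexCoord k) (l : Fin k) (hl : c'.1 = Pi.single l 1) :
    ∑ c, codeSimplexVertex k c c' • x c = (2 : ℤ) • x (unitPoint l) := by
  have hu : ∃ l, c'.1 = Pi.single l 1 := ⟨l, hl⟩
  rw [Finset.sum_eq_single (unitPoint l)]
  · have h1 : (unitPoint l).1 = c'.1 := hl.symm
    simp only [codeSimplexVertex, h1, if_true, if_pos hu]
  · intro c _ hc
    have h1 : c.1 ≠ c'.1 := fun h => hc (Subtype.ext (h.trans hl))
    simp only [codeSimplexVertex, if_neg h1, hu, not_true_eq_false, and_false, if_false, zero_smul]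
  · simp

theorem sum_codeSimplexVertex_nonunit {k : ℕ} {M : Type*} [AddCommGroup M]
    (x : BinaryPoint k → M) (c' : CodeSimplexCoord k) (hc' : ¬ ∃ l, c'.1 = Pi.single l 1) :
    ∑ c, codeSimplexVertex k c c' • x c
      = x ⟨c'.1, c'.2.1⟩ - ∑ l, if c'.1 l = 1 then x (unitPoint l) else 0 := by
  have key : ∀ c : BinaryPoint k, codeSimplexVertex k c c' • x c
      = (if c = ⟨c'.1, c'.2.1⟩ then x c else 0)
        - ∑ l, if c = unitPoint l then (if c'.1 l = 1 then x c else 0) else 0 := by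
    intro c
    by_cases h : c.1 = c'.1
    · have h1 : c = ⟨c'.1, c'.2.1⟩ := Subtype.ext h
      have h2 : ¬ ∃ l, c.1 = Pi.single l 1 := by rwa [h]
      have h3 : ∀ l, c ≠ unitPoint l := fun l hl => h2 ⟨l, by rw [hl]; rfl⟩
      simp only [codeSimplexVertex, if_pos h, if_neg h2, if_pos h1, h3, if_false,
        Finset.sum_const_zero, one_smul, sub_zero]
    · have h1 : c ≠ ⟨c'.1, c'.2.1⟩ := fun h' => h (by rw [h'])
      simp only [codeSimplexVertex, if_neg h, if_neg h1, hc', not_false_eq_true, and_true, zero_sub]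
      by_cases h2 : ∃ l, c = unitPoint l
      · obtain ⟨l, hl⟩ := h2
        have h3 : ∀ m, c = unitPoint m ↔ m = l := by
          intro m
          constructor
          · intro hm
            by_contra hne
            have := congrFun (congrArg Subtype.val (hm.symm.trans hl)) m
            simp [unitPoint, hne] at this
          · rintro rfl; exact hl
        have h4 : (∃ m, c.1 = Pi.single m 1 ∧ c'.1 m = 1) ↔ c'.1 l = 1 := by
          constructor
          · rintro ⟨m, hm, hm'⟩
            rwa [(h3 m).1 (Subtype.ext hm)] at hm'
          · intro h; exact ⟨l, by rw [hl]; rfl, h⟩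
        simp only [h3, h4, Finset.sum_ite_eq', Finset.mem_univ, if_true]
        split_ifs <;> simp
      · have h3 : ∀ l, c ≠ unitPoint l := fun l hl => h2 ⟨l, hl⟩
        have h4 : ¬ ∃ m, c.1 = Pi.single m 1 ∧ c'.1 m = 1 := by
          rintro ⟨m, hm, _⟩
          exact h3 m (Subtype.ext hm)
        simp [h3, h4]
  simp only [key, Finset.sum_sub_distrib, Finset.sum_ite_eq', Finset.mem_univ, if_true]
  congr 1
  rw [Finset.sum_comm]
  simp only [Finset.sum_ite_eq', Finset.mem_univ, if_true]

theorem card_binaryPoint (k : ℕ) (hk : 2 ≤ k) :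
    Fintype.card (BinaryPoint k) = Fintype.card (CodeSimplexCoord k) + 1 := by
  have h1 : (1 : Fin k → ZMod 2) ≠ 0 := by
    intro h
    simpa using congrFun h ⟨0, by omega⟩
  rw [← Fintype.card_option]
  refine (Fintype.card_congr
    { toFun := fun o : Option (CodeSimplexCoord k) =>
        (o.elim ⟨1, h1⟩ fun c => ⟨c.1, c.2.1⟩ : BinaryPoint k)
      invFun := fun c : BinaryPoint k => if h : c.1 = 1 then none else some ⟨c.1, c.2, h⟩
      left_inv := ?_
      right_inv := ?_ }).symm
  · rintro (_ | c)
    · simp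
    · simp [c.2.2]
  · intro c
    by_cases h : c.1 = 1
    · simp only [h, dif_pos, Option.elim]
      exact Subtype.ext h.symm
    · simp [h]

theorem affineIndependent_codeSimplexVertex (k : ℕ) (hk : 2 ≤ k) :
    AffineIndependent ℝ (fun c => latticePoint (codeSimplexVertex k c)) := by
  rw [affineIndependent_iff]
  intro t w hw hw'
  set x : BinaryPoint k → ℝ := fun c => if c ∈ t then w c else 0 with hx
  have h0 : ∀ c', ∑ c, codeSimplexVertex k c c' • x c = 0 := by
    intro c'
    have := congrFun hw' c'
    simp only [Finset.sum_apply, Pi.smul_apply, latticePoint, smul_eq_mul, Pi.zero_apply] at this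
    rw [← this]
    simp only [hx, zsmul_eq_mul, mul_ite, mul_zero, Finset.sum_ite_mem, Finset.univ_inter]
    exact Finset.sum_congr rfl fun c _ => mul_comm _ _
  have hs : ∑ c, x c = 0 := by
    simpa [hx, Finset.sum_ite_mem] using hw
  have hunit : ∀ l, x (unitPoint l) = 0 := by
    intro l
    have := h0 ⟨Pi.single l 1, by simp, single_ne_one hk l⟩
    rw [sum_codeSimplexVertex_unit x _ l rfl] at this
    simpa using this
  have hne : ∀ c : BinaryPoint k, c.1 ≠ 1 → x c = 0 := by
    intro c hc
    by_cases hu : ∃ l, c.1 = Pi.single l 1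
    · obtain ⟨l, hl⟩ := hu
      rw [show c = unitPoint l from Subtype.ext hl]; exact hunit l
    · have := h0 ⟨c.1, c.2, hc⟩
      rw [sum_codeSimplexVertex_nonunit x _ hu] at this
      simpa [hunit] using this
  intro c hc
  have hxc : x c = 0 := by
    by_cases h : c.1 = 1
    · rw [← hs]
      refine (Fintype.sum_eq_single c fun d hd => hne d fun h' => hd ?_).symm
      exact Subtype.ext (h'.trans h.symm)
    · exact hne c h
  simpa [hx, hc] using hxc

theorem mem_codeGroup_simplexCode {k : ℕ} (y : BinaryPoint k → UnitAddCircle) :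
    y ∈ codeGroup (binarySimplexCode k) ↔
      ∃ b : Fin k → ZMod 2, ∀ c, y c = ZMod.toAddCircle (∑ l, b l * c.1 l) := by
  simp only [codeGroup, AddSubgroup.mem_map, Submodule.mem_toAddSubgroup, binarySimplexCode,
    Submodule.mem_span_range_iff_exists_fun]
  constructor
  · rintro ⟨a, ⟨b, rfl⟩, rfl⟩
    refine ⟨b, fun c => ?_⟩
    simp [simplexCodeMatrix, Matrix.row, Finset.sum_apply]
  · rintro ⟨b, hb⟩
    refine ⟨_, ⟨b, rfl⟩, funext fun c => ?_⟩
    rw [hb]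
    simp [simplexCodeMatrix, Matrix.row, Finset.sum_apply]

theorem sum_apply_binaryPoint {k : ℕ} (hk : 2 ≤ k) (l : Fin k) :
    ∑ c : BinaryPoint k, c.1 l = 0 := by
  have : Nontrivial (Fin k) := Fin.nontrivial_iff_two_le.mpr hk
  obtain ⟨m, hm⟩ := exists_ne l
  have h1 : ∑ c : Fin k → ZMod 2, c l = 0 := by
    refine Finset.sum_involution (fun c _ => c + Pi.single m 1) ?_ ?_ ?_ ?_
    · intro c _
      simp [hm.symm, CharTwo.add_self_eq_zero]
    · intro c _ _ h
      have := congrFun h m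
      simp at this
    · simp
    · intro c _
      rw [add_assoc, CharTwo.add_self_eq_zero, add_zero]
  rw [← h1, ← Finset.sum_erase_add Finset.univ _ (Finset.mem_univ (0 : Fin k → ZMod 2))]
  simp only [Pi.zero_apply, add_zero]
  exact (Finset.sum_subtype _ (by simp) fun c : Fin k → ZMod 2 => c l).symm

theorem exists_toAddCircle_of_two_smul {y : UnitAddCircle} (h : (2 : ℤ) • y = 0) :
    ∃ b : ZMod 2, y = ZMod.toAddCircle b := by
  have h' : (2 : ℕ) • y = 0 := by simpa [two_smul] using h
  obtain ⟨m, _, hm⟩ := (AddCircle.nsmul_eq_zero_iff (by norm_num)).1 h'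
  exact ⟨(m : ZMod 2), by rw [ZMod.toAddCircle_natCast, ← hm, mul_one]⟩

/-- `Δ(k)` is indeed a lattice simplex whose group is that of the binary simplex code. -/
theorem codeSimplex_spec (k : ℕ) (hk : 2 ≤ k) : ArisesFromSimplexCode k (codeSimplex k) := by
  refine ⟨codeSimplexVertex k, ⟨card_binaryPoint k hk, affineIndependent_codeSimplexVertex k hk,
    rfl⟩, ?_⟩
  have hval : ∀ (b : Fin k → ZMod 2) l,
      (∑ m, b m * (unitPoint l).1 m) = b l := by
    intro b l
    simp [unitPoint, Pi.single_apply]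
  have hsum : ∀ b : Fin k → ZMod 2,
      ∑ c : BinaryPoint k, ZMod.toAddCircle (∑ l, b l * c.1 l) = 0 := by
    intro b
    rw [← map_sum, Finset.sum_comm]
    simp only [← Finset.mul_sum, sum_apply_binaryPoint hk, mul_zero, Finset.sum_const_zero,
      map_zero]
  have hnon : ∀ (b : Fin k → ZMod 2) (c : Fin k → ZMod 2),
      ZMod.toAddCircle (∑ l, b l * c l) = ∑ l, if c l = 1 then ZMod.toAddCircle (b l) else 0 := by
    intro b c
    rw [map_sum]
    refine Finset.sum_congr rfl fun l _ => ?_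
    by_cases h : c l = 1
    · simp [h]
    · have : c l = 0 := by
        by_contra h'
        exact h (zmod_two_eq_one h')
      simp [this]
  ext x
  rw [mem_codeGroup_simplexCode]
  constructor
  · rintro ⟨h0, hs⟩
    have hunit : ∀ l, ∃ b : ZMod 2, x (unitPoint l) = ZMod.toAddCircle b := by
      intro l
      have := h0 ⟨Pi.single l 1, by simp, single_ne_one hk l⟩
      rw [sum_codeSimplexVertex_unit x _ l rfl] at this
      exact exists_toAddCircle_of_two_smul this
    choose b hb using hunit
    have hne : ∀ c : BinaryPoint k, c.1 ≠ 1 → x c = ZMod.toAddCircle (∑ l, b l * c.1 l) := by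
      intro c hc
      by_cases hu : ∃ l, c.1 = Pi.single l 1
      · obtain ⟨l, hl⟩ := hu
        rw [show c = unitPoint l from Subtype.ext hl, hval, hb]
      · have := h0 ⟨c.1, c.2, hc⟩
        rw [sum_codeSimplexVertex_nonunit x _ hu, sub_eq_zero] at this
        rw [hnon]
        simpa only [hb] using this
    refine ⟨b, fun c => ?_⟩
    by_cases h : c.1 = 1
    · rw [← sub_eq_zero]
      have h2 : ∑ d : BinaryPoint k, (x d - ZMod.toAddCircle (∑ l, b l * d.1 l)) = 0 := by
        rw [Finset.sum_sub_distrib, hs, hsum, sub_zero]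
      rw [← h2]
      refine (Fintype.sum_eq_single c fun d hd => sub_eq_zero.2 (hne d fun h' => hd ?_)).symm
      exact Subtype.ext (h'.trans h.symm)
    · exact hne c h
  · rintro ⟨b, hb⟩
    obtain rfl : x = fun c => ZMod.toAddCircle (∑ l, b l * c.1 l) := funext hb
    refine ⟨fun c' => ?_, hsum b⟩
    by_cases hu : ∃ l, c'.1 = Pi.single l 1
    · obtain ⟨l, hl⟩ := hu
      rw [sum_codeSimplexVertex_unit _ _ l hl, ← map_zsmul]
      have : ∀ a : ZMod 2, (2 : ℤ) • a = 0 := by decide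
      rw [this, map_zero]
    · rw [sum_codeSimplexVertex_nonunit _ _ hu, sub_eq_zero]
      simp only [hval]
      exact hnon b c'.1

/-! The `h^*`-polynomial of a lattice simplex is the sum of t^height(x) over x in Λ, where the
height adds up the coordinates represented in [0, 1). Each nonzero coordinate of x contributes 1 to
height(x) + height(-x), so degree s leaves every x in Λ at most 2s nonzero coordinates out of 4s -
1. Since Δ is not a pyramid, no coordinate vanishes on all of Λ: the kernels K_j of the coordinates
are proper subgroups.

The core is a double count, `AddSubgroup.index_eq_two_of_weight_le`. Put wt(g) = 4s - 2 |supp g| ≥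
0. The sum of wt over the g outside K_j equals the sum over i ≠ j of |K_i \ K_j| - |Λ \ (K_i ∪
K_j)|, and each of these terms is ≤ 0 by a translation argument. Hence everything vanishes: the K_j
are distinct of index 2, every nonzero g has exactly 2s nonzero coordinates, and |Λ| = 4s.

So Λ is an 𝔽₂-vector space of order 2^k = 4s, and its 2^k - 1 coordinates are distinct nonzero
functionals, hence all of them. This is the simplex code (`AddSubgroup.exists_equiv_binaryPoint`).
Finally, Λ determines the simplex up to unimodular equivalence
(`IsLatticeSimplexWithVertices.unimodularlyEquivalent`). -/

/-! ### Double counting with proper subgroups of a finite abelian group. -/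

/-- Translation by t injects H \ K into the complement of H ∪ K. With equal cardinalities it is
onto, so every y outside both subgroups is a translate of an element of H. -/
theorem AddSubgroup.card_mem_notMem_le_of_translate {G : Type*} [AddCommGroup G] [Fintype G]
    {H K : AddSubgroup G} {t : G} (ht : t ∉ H) (htK : t ∈ K ∨ K ≤ H) :
    Set.ncard {g | g ∈ H ∧ g ∉ K} ≤ Set.ncard {g | g ∉ H ∧ g ∉ K} ∧
      (Set.ncard {g | g ∈ H ∧ g ∉ K} = Set.ncard {g | g ∉ H ∧ g ∉ K} →
        ∀ y, y ∉ H → y ∉ K → y - t ∈ H) := by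
  have hmaps : ∀ x, x ∈ H → x ∉ K → x + t ∉ H ∧ x + t ∉ K := by
    intro x hx hxK
    have h1 : x + t ∉ H := fun h => ht (by simpa using H.sub_mem h hx)
    refine ⟨h1, fun h => ?_⟩
    rcases htK with htK | htK
    · exact hxK (by simpa using K.sub_mem h htK)
    · exact h1 (htK h)
  have hsub : (· + t) '' {g | g ∈ H ∧ g ∉ K} ⊆ {g | g ∉ H ∧ g ∉ K} := by
    rintro _ ⟨x, hx, rfl⟩
    exact hmaps x hx.1 hx.2
  have hcard : Set.ncard ((· + t) '' {g | g ∈ H ∧ g ∉ K}) = Set.ncard {g | g ∈ H ∧ g ∉ K} :=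
    Set.ncard_image_of_injective _ (add_left_injective t)
  refine ⟨hcard ▸ Set.ncard_le_ncard hsub (Set.toFinite _), fun h y hy hyK => ?_⟩
  have heq := Set.eq_of_subset_of_ncard_le hsub (by rw [hcard, h]) (Set.toFinite _)
  obtain ⟨x, hx, rfl⟩ := heq.ge (show y ∈ {g | g ∉ H ∧ g ∉ K} from ⟨hy, hyK⟩)
  simpa using hx.1

theorem AddSubgroup.card_mem_notMem_le {G : Type*} [AddCommGroup G] [Fintype G]
    {H : AddSubgroup G} (K : AddSubgroup G) (hH : H ≠ ⊤) :
    Set.ncard {g | g ∈ H ∧ g ∉ K} ≤ Set.ncard {g | g ∉ H ∧ g ∉ K} := by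
  by_cases h : K ≤ H
  · obtain ⟨t, -, ht⟩ := SetLike.exists_of_lt hH.lt_top
    exact (card_mem_notMem_le_of_translate ht (Or.inr h)).1
  · obtain ⟨t, htK, ht⟩ := SetLike.not_le_iff_exists.1 h
    exact (card_mem_notMem_le_of_translate ht (Or.inl htK)).1

theorem AddSubgroup.index_eq_two_of_card_mem_notMem_eq {G : Type*} [AddCommGroup G] [Fintype G]
    {H K : AddSubgroup G} (hH : H ≠ ⊤) (hK : K ≠ ⊤)
    (heq : Set.ncard {g | g ∈ H ∧ g ∉ K} = Set.ncard {g | g ∉ H ∧ g ∉ K}) : H.index = 2 := by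
  obtain ⟨t, ht, htK⟩ : ∃ t, t ∉ H ∧ (t ∈ K ∨ K ≤ H) := by
    by_cases h : K ≤ H
    · obtain ⟨t, -, ht⟩ := SetLike.exists_of_lt hH.lt_top
      exact ⟨t, ht, Or.inr h⟩
    · obtain ⟨t, htK, ht⟩ := SetLike.not_le_iff_exists.1 h
      exact ⟨t, ht, Or.inl htK⟩
  have key : ∀ a, a ∉ H → a - t ∈ H := by
    intro a ha
    by_cases haK : a ∈ K
    -- For a in K, compare through some y outside both subgroups: translations by t and by a are
    -- both admissible, so y - t and y - a lie in H, hence so does a - t.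
    · obtain ⟨c, -, hc⟩ := SetLike.exists_of_lt hK.lt_top
      obtain ⟨y, hy, hyK⟩ : ∃ y, y ∉ H ∧ y ∉ K := by
        by_cases hcH : c ∈ H
        · exact ⟨c + a, fun h => ha (by simpa using H.sub_mem h hcH),
            fun h => hc (by simpa using K.sub_mem h haK)⟩
        · exact ⟨c, hcH, hc⟩
      have h1 := (card_mem_notMem_le_of_translate ht htK).2 heq y hy hyK
      have h2 := (card_mem_notMem_le_of_translate ha (Or.inl haK)).2 heq y hy hyK
      simpa using H.sub_mem h1 h2
    · exact (card_mem_notMem_le_of_translate ht htK).2 heq a ha haK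
  refine AddSubgroup.index_eq_two_iff.2 ⟨-t, fun b => ?_⟩
  rw [← sub_eq_add_neg]
  by_cases hb : b ∈ H
  · exact Or.inr ⟨hb, fun h => ht (by simpa using H.sub_mem hb h)⟩
  · exact Or.inl ⟨key b hb, hb⟩

theorem Set.natCast_ncard_setOf {α : Type*} [Fintype α] (p : α → Prop) [DecidablePred p] :
    (Set.ncard {a | p a} : ℤ) = ∑ a, if p a then 1 else 0 := by
  rw [Set.ncard_eq_toFinset_card', Finset.sum_boole]
  simp

/-- A family of proper subgroups such that every element lies outside at most half of them
(up to rounding) consists of all the subgroups of index two. -/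
theorem AddSubgroup.index_eq_two_of_weight_le {G J : Type*} [AddCommGroup G] [Fintype G]
    [Fintype J] (K : J → AddSubgroup G) (hK : ∀ j, K j ≠ ⊤)
    (hw : ∀ g, 2 * Set.ncard {j | g ∉ K j} ≤ Fintype.card J + 1) (hJ : 2 ≤ Fintype.card J)
    (hinf : ∀ g, (∀ j, g ∈ K j) → g = 0) :
    (∀ j, (K j).index = 2) ∧ Function.Injective K ∧ Fintype.card G = Fintype.card J + 1 := by
  classical
  set wt : G → ℤ := fun g => (Fintype.card J : ℤ) + 1 - 2 * Set.ncard {j | g ∉ K j} with hwt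
  have hwt0 : ∀ g, 0 ≤ wt g := by
    intro g
    have := hw g
    simp only [hwt]
    omega
  have hwt_eq : ∀ g, wt g = 1 + ∑ i, ((if g ∈ K i then 1 else 0) - if g ∉ K i then 1 else 0) := by
    intro g
    have h1 : (Fintype.card J : ℤ) = ∑ i, ((if g ∈ K i then 1 else 0) + if g ∉ K i then 1 else 0) := by
      rw [Finset.sum_congr rfl (g := fun _ => 1)]
      · simp
      · intro i _
        by_cases h : g ∈ K i <;> simp [h]
    have h2 := Set.natCast_ncard_setOf (fun j => g ∉ K j)
    rw [Finset.sum_sub_distrib]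
    rw [Finset.sum_add_distrib] at h1
    simp only [hwt]
    linarith
  set D : J → J → ℤ := fun j i =>
    (Set.ncard {g | g ∈ K i ∧ g ∉ K j} : ℤ) - Set.ncard {g | g ∉ K i ∧ g ∉ K j} with hD
  have hD0 : ∀ j i, D j i ≤ 0 := by
    intro j i
    have := AddSubgroup.card_mem_notMem_le (K j) (hK i)
    simp only [hD]
    omega
  -- For g outside K_j the term i = j of `hwt_eq` is -1 and cancels the constant 1; this is where
  -- the +1 in the weight is needed.
  have hsum : ∀ j, ∑ g, (if g ∉ K j then wt g else 0) = ∑ i ∈ Finset.univ.erase j, D j i := by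
    intro j
    have h1 : ∀ g, (if g ∉ K j then wt g else 0) = ∑ i ∈ Finset.univ.erase j,
        ((if g ∈ K i ∧ g ∉ K j then 1 else 0) - if g ∉ K i ∧ g ∉ K j then 1 else 0) := by
      intro g
      by_cases hg : g ∈ K j
      · simp [hg]
      · rw [if_pos hg, hwt_eq, ← Finset.add_sum_erase _ _ (Finset.mem_univ j)]
        simp [hg]
    rw [Finset.sum_congr rfl fun g _ => h1 g, Finset.sum_comm]
    refine Finset.sum_congr rfl fun i _ => ?_
    rw [Finset.sum_sub_distrib, ← Set.natCast_ncard_setOf, ← Set.natCast_ncard_setOf]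
  -- The left side of `hsum` is a sum of nonnegative terms and the right side of nonpositive ones,
  -- so all terms are zero.
  have hzero : ∀ j, (∀ g, g ∉ K j → wt g = 0) ∧ ∀ i, i ≠ j → D j i = 0 := by
    intro j
    have hl : 0 ≤ ∑ g, (if g ∉ K j then wt g else 0) :=
      Finset.sum_nonneg fun g _ => by split_ifs <;> simp [hwt0]
    have hr : ∑ i ∈ Finset.univ.erase j, D j i ≤ 0 := Finset.sum_nonpos fun i _ => hD0 j i
    have hs := hsum j
    constructor
    · intro g hg
      have h0 : ∑ g, (if g ∉ K j then wt g else 0) = 0 := by linarith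
      rw [Finset.sum_eq_zero_iff_of_nonneg (fun g _ => by split_ifs <;> simp [hwt0])] at h0
      simpa [hg] using h0 g (Finset.mem_univ g)
    · intro i hi
      have h0 : ∑ i ∈ Finset.univ.erase j, D j i = 0 := by linarith
      rw [Finset.sum_eq_zero_iff_of_nonpos (fun i _ => hD0 j i)] at h0
      exact h0 i (by simp [hi])
  have : Nontrivial J := Fintype.one_lt_card_iff_nontrivial.1 hJ
  have hidx : ∀ j, (K j).index = 2 := by
    intro i
    obtain ⟨j, hj⟩ := exists_ne i
    refine AddSubgroup.index_eq_two_of_card_mem_notMem_eq (hK i) (hK j) ?_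
    have := (hzero j).2 i hj.symm
    simp only [hD] at this
    omega
  refine ⟨hidx, ?_, ?_⟩
  · intro i j hij
    by_contra hne
    -- If K_i = K_j, then K_i \ K_j is empty while the complement is not, so `D j i` would be
    -- negative.
    have h0 := (hzero j).2 i hne
    obtain ⟨t, -, ht⟩ := SetLike.exists_of_lt (hK j).lt_top
    have h1 : 0 < Set.ncard {g | g ∉ K i ∧ g ∉ K j} :=
      (Set.ncard_pos (Set.toFinite _)).2 ⟨t, by simp [hij, ht]⟩
    simp only [hD, hij, and_not_self_iff, Set.ofPred_false, Set.ncard_empty] at h0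
    rw [hij] at h1
    simp only [Nat.cast_zero, zero_sub, neg_eq_zero, Nat.cast_eq_zero] at h0
    omega
  · have hwt_ne : ∀ g, g ≠ 0 → wt g = 0 := by
      intro g hg
      obtain ⟨j, hj⟩ : ∃ j, g ∉ K j := by
        by_contra! h
        exact hg (hinf g h)
      exact (hzero j).1 g hj
    -- The total weight is evaluated twice: only g = 0 contributes, and each index-two subgroup is
    -- as large as its complement, which leaves 1 for every g.
    have h1 : ∑ g, wt g = Fintype.card J + 1 := by
      rw [Fintype.sum_eq_single 0 hwt_ne]
      simp [hwt, (K _).zero_mem]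
    have h2 : ∀ i, ∑ g, ((if g ∈ K i then (1 : ℤ) else 0) - if g ∉ K i then 1 else 0) = 0 := by
      intro i
      obtain ⟨a, ha⟩ := AddSubgroup.index_eq_two_iff.1 (hidx i)
      rw [Finset.sum_sub_distrib, sub_eq_zero]
      refine (Fintype.sum_equiv (Equiv.addRight a) _ _ fun g => ?_)
      have := ha g
      by_cases hg : g ∈ K i <;> simp_all [Xor]
    have h3 : ∑ g, wt g = Fintype.card G := by
      simp only [hwt_eq]
      rw [Finset.sum_add_distrib, Finset.sum_comm, Finset.sum_eq_zero fun i _ => h2 i]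
      simp
    exact_mod_cast h3.symm.trans h1

/-! ### Recognition of the binary simplex code. -/

theorem AddSubgroup.two_nsmul_eq_zero_of_index_eq_two {G J : Type*} [AddCommGroup G]
    (K : J → AddSubgroup G) (hK : ∀ j, (K j).index = 2) (hinf : ∀ g, (∀ j, g ∈ K j) → g = 0)
    (g : G) : 2 • g = 0 :=
  hinf _ fun j => AddSubgroup.two_smul_mem_of_index_two (hK j) g

/-- A finite subgroup of a torus `(ℝ/ℤ)^J` with `|J| + 1 = 4s`, not contained in a coordinate
subtorus, and all of whose elements have at most `2s` nonzero coordinates, is the group of a binary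
simplex code. -/
theorem AddSubgroup.exists_equiv_binaryPoint {J : Type*} [Fintype J] {s : ℕ}
    (hJ : Fintype.card J + 1 = 4 * s) (Λ : AddSubgroup (J → UnitAddCircle)) [Finite Λ]
    (hne : ∀ j, ∃ x ∈ Λ, x j ≠ 0) (hw : ∀ x ∈ Λ, Set.ncard {j | x j ≠ 0} ≤ 2 * s) :
    ∃ (r : ℕ) (e : BinaryPoint (r + 2) ≃ J), s = 2 ^ r ∧
      ∀ x, x ∈ Λ ↔ x ∘ e ∈ codeGroup (binarySimplexCode (r + 2)) := by
  classical
  have := Fintype.ofFinite Λ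
  let ev : J → Λ →+ UnitAddCircle := fun j => (Pi.evalAddMonoidHom _ j).comp Λ.subtype
  have hmem : ∀ (x : Λ) j, x ∈ (ev j).ker ↔ x.1 j = 0 := fun x j => Iff.rfl
  have hinf : ∀ x : Λ, (∀ j, x ∈ (ev j).ker) → x = 0 :=
    fun x hx => Subtype.ext (funext fun j => (hmem x j).1 (hx j))
  obtain ⟨hidx, hinj, hcard⟩ := AddSubgroup.index_eq_two_of_weight_le (fun j => (ev j).ker)
    (fun j h => by
      obtain ⟨x, hx, hxj⟩ := hne j
      exact hxj ((hmem ⟨x, hx⟩ j).1 (h ▸ AddSubgroup.mem_top _)))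
    (fun g => by
      have := hw g.1 g.2
      change 2 * Set.ncard {j | g.1 j ≠ 0} ≤ _
      omega) (by omega) hinf
  have htwo := AddSubgroup.two_nsmul_eq_zero_of_index_eq_two _ hidx hinf
  let _ : Module (ZMod 2) Λ := AddCommGroup.zmodModule htwo
  have hlift : ∀ (x : Λ) j, ∃ b : ZMod 2, x.1 j = ZMod.toAddCircle b := by
    intro x j
    refine exists_toAddCircle_of_two_smul ?_
    have := congrFun (congrArg Subtype.val (htwo x)) j
    simpa [two_smul] using this
  choose b hb using hlift
  let ψ : J → Λ →ₗ[ZMod 2] ZMod 2 := fun j => AddMonoidHom.toZModLinearMap 2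
    { toFun := fun x => b x j
      map_zero' := ZMod.toAddCircle_injective 2 (by rw [← hb]; simp)
      map_add' := fun x y => ZMod.toAddCircle_injective 2 (by rw [map_add, ← hb, ← hb, ← hb]; rfl) }
  have hψ : ∀ (x : Λ) j, x.1 j = ZMod.toAddCircle (ψ j x) := hb
  obtain ⟨k, hk⟩ : ∃ k, Module.finrank (ZMod 2) Λ = k := ⟨_, rfl⟩
  have hpow : 4 * s = 2 ^ k := by
    rw [← hJ, ← hcard, Module.card_eq_pow_finrank (K := ZMod 2), ZMod.card, hk]
  obtain ⟨r, rfl⟩ : ∃ r, k = r + 2 := by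
    refine ⟨k - 2, ?_⟩
    have : k ≠ 0 := by rintro rfl; omega
    have : k ≠ 1 := by rintro rfl; omega
    omega
  let B := Module.finBasisOfFinrankEq (ZMod 2) Λ hk
  have hexp : ∀ (x : Λ) j, ψ j x = ∑ l, B.repr x l * ψ j (B l) := by
    intro x j
    conv_lhs => rw [← B.sum_repr x]
    simp only [map_sum, map_smul, smul_eq_mul]
  -- The columns of the generator matrix of Λ with respect to the basis `B`. They are nonzero
  -- because no coordinate vanishes on Λ, and distinct because the kernels are.
  let c : J → BinaryPoint (r + 2) := fun j => ⟨fun l => ψ j (B l), fun h => by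
    obtain ⟨x, hx, hxj⟩ := hne j
    refine hxj ?_
    change (⟨x, hx⟩ : Λ).1 j = 0
    rw [hψ, hexp]
    have : ∀ l, ψ j (B l) = 0 := fun l => congrFun h l
    simp [this]⟩
  have hc : Function.Injective c := by
    intro i j hij
    refine hinj ?_
    ext x
    have : ∀ l, ψ i (B l) = ψ j (B l) := fun l => congrFun (congrArg Subtype.val hij) l
    rw [hmem, hmem, hψ, hψ, hexp x i, hexp x j]
    simp only [this]
  have hcardJ : Fintype.card J = Fintype.card (BinaryPoint (r + 2)) := by
    have h1 : Fintype.card (BinaryPoint (r + 2)) = 2 ^ (r + 2) - 1 := by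
      rw [Fintype.card_subtype_compl (fun c : Fin (r + 2) → ZMod 2 => c = 0)]
      simp
    omega
  -- There are |J| = 2^(r+2) - 1 columns, so every nonzero vector occurs exactly once.
  let e := Equiv.ofBijective c ((Fintype.bijective_iff_injective_and_card c).2 ⟨hc, hcardJ⟩)
  refine ⟨r, e.symm, ?_, fun x => ?_⟩
  · rw [pow_add] at hpow
    omega
  · rw [mem_codeGroup_simplexCode]
    have hval : ∀ a l, a.1 l = ψ (e.symm a) (B l) := by
      intro a l
      conv_lhs => rw [← e.apply_symm_apply a]
      rfl
    constructor
    · intro hx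
      refine ⟨B.repr ⟨x, hx⟩, fun a => ?_⟩
      simp only [Function.comp_apply, hval]
      rw [← hexp]
      exact hψ ⟨x, hx⟩ _
    · rintro ⟨β, hβ⟩
      have : x = (∑ l, β l • B l : Λ) := by
        funext j
        have h1 := hβ (e j)
        simp only [Function.comp_apply, hval, e.symm_apply_apply] at h1
        rw [h1, hψ]
        simp
      rw [this]
      exact Subtype.prop _

/-! ### Homogeneous barycentric coordinates. -/

/-- The linear map sending coefficients `f` to `(∑ f_j v_j, ∑ f_j)`. -/
noncomputable def homogenization {ι J : Type*} [Fintype J] (v : J → ι → ℤ) :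
    (J → ℝ) →ₗ[ℝ] (ι → ℝ) × ℝ :=
  (Fintype.linearCombination ℝ fun j => latticePoint (v j)).prod
    (Fintype.linearCombination ℝ fun _ => (1 : ℝ))

theorem homogenization_fst {ι J : Type*} [Fintype J] (v : J → ι → ℤ) (f : J → ℝ) (i : ι) :
    (homogenization v f).1 i = ∑ j, f j * v j i := by
  simp [homogenization, Fintype.linearCombination_apply, latticePoint]

theorem homogenization_snd {ι J : Type*} [Fintype J] (v : J → ι → ℤ) (f : J → ℝ) :
    (homogenization v f).2 = ∑ j, f j := by
  simp [homogenization, Fintype.linearCombination_apply]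

theorem homogenization_single {ι J : Type*} [Fintype J] [DecidableEq J] (v : J → ι → ℤ) (j : J) :
    homogenization v (Pi.single j 1) = (latticePoint (v j), 1) := by
  refine Prod.ext (funext fun i => ?_) ?_
  · rw [homogenization_fst]
    simp [Pi.single_apply, latticePoint]
  · rw [homogenization_snd]
    simp

/-- Turns congruences in ℝ/ℤ into integrality of real coefficients: Λ is the preimage of the lattice
ℤ^ι × ℤ under `homogenization`, reduced modulo ℤ^J. -/
theorem coe_mem_simplexGroup {ι J : Type*} [Fintype J] (v : J → ι → ℤ) (f : J → ℝ) :
    (fun j => (f j : UnitAddCircle)) ∈ simplexGroup v ↔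
      ∃ (z : ι → ℤ) (m : ℤ), homogenization v f = (latticePoint z, (m : ℝ)) := by
  have hcoe : ∀ a : ℝ, (a : UnitAddCircle) = 0 ↔ ∃ m : ℤ, a = m := by
    intro a
    rw [AddCircle.coe_eq_zero_iff]
    simp [eq_comm]
  have hsum : ∀ g : J → ℝ, ∑ j, (g j : UnitAddCircle) = ((∑ j, g j : ℝ) : UnitAddCircle) :=
    fun g => (map_sum (QuotientAddGroup.mk' _) g _).symm
  have h1 : ∀ i, ∑ j, v j i • (f j : UnitAddCircle) = ((∑ j, f j * v j i : ℝ) : UnitAddCircle) := by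
    intro i
    rw [← hsum]
    refine Finset.sum_congr rfl fun j _ => ?_
    rw [← AddCircle.coe_zsmul, zsmul_eq_mul, mul_comm]
  change ((∀ i, ∑ j, v j i • (f j : UnitAddCircle) = 0) ∧ ∑ j, (f j : UnitAddCircle) = 0) ↔ _
  simp only [h1, hsum, hcoe]
  constructor
  · rintro ⟨hz, m, hm⟩
    choose z hz using hz
    refine ⟨z, m, Prod.ext (funext fun i => ?_) ?_⟩
    · rw [homogenization_fst, hz]
      rfl
    · rw [homogenization_snd, hm]
  · rintro ⟨z, m, h⟩
    refine ⟨fun i => ⟨z i, ?_⟩, m, ?_⟩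
    · rw [← homogenization_fst, h]
      rfl
    · rw [← homogenization_snd, h]

theorem IsLatticeSimplexWithVertices.bijective_homogenization {ι J : Type*} [Fintype ι] [Fintype J]
    {v : J → ι → ℤ} {P : Set (ι → ℝ)} (h : IsLatticeSimplexWithVertices v P) :
    Function.Bijective (homogenization v) := by
  have hinj : Function.Injective (homogenization v) := by
    rw [← LinearMap.ker_eq_bot, LinearMap.ker_eq_bot']
    intro f hf
    have h1 := affineIndependent_iff.1 h.affineIndependent Finset.univ f
      (by rw [← homogenization_snd v, hf]; rfl)
      (by
        funext i
        have := congrFun (congrArg Prod.fst hf) i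
        rw [homogenization_fst] at this
        simpa [latticePoint] using this)
    exact funext fun j => h1 j (Finset.mem_univ j)
  refine ⟨hinj, (LinearMap.injective_iff_surjective_of_finrank_eq_finrank ?_).1 hinj⟩
  simp [h.card_eq]

/-- Homogeneous barycentric coordinates of a lattice simplex. -/
noncomputable def IsLatticeSimplexWithVertices.homogeneousEquiv {ι J : Type*} [Fintype ι]
    [Fintype J] {v : J → ι → ℤ} {P : Set (ι → ℝ)} (h : IsLatticeSimplexWithVertices v P) :
    (J → ℝ) ≃ₗ[ℝ] (ι → ℝ) × ℝ :=
  LinearEquiv.ofBijective (homogenization v) h.bijective_homogenization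

theorem IsLatticeSimplexWithVertices.homogeneousEquiv_apply {ι J : Type*} [Fintype ι]
    [Fintype J] {v : J → ι → ℤ} {P : Set (ι → ℝ)} (h : IsLatticeSimplexWithVertices v P)
    (f : J → ℝ) : h.homogeneousEquiv f = homogenization v f := rfl

theorem IsLatticeSimplexWithVertices.coe_symm_mem_simplexGroup {ι J : Type*} [Fintype ι]
    [Fintype J] {v : J → ι → ℤ} {P : Set (ι → ℝ)} (h : IsLatticeSimplexWithVertices v P)
    (z : ι → ℤ) (m : ℤ) :
    (fun j => (h.homogeneousEquiv.symm (latticePoint z, (m : ℝ)) j : UnitAddCircle)) ∈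
      simplexGroup v :=
  (coe_mem_simplexGroup v _).2 ⟨z, m, h.homogeneousEquiv.apply_symm_apply _⟩

/-! ### The group Λ determines the simplex up to unimodular equivalence. -/

theorem latticePoint_single {ι : Type*} [DecidableEq ι] (i : ι) :
    latticePoint (Pi.single i 1 : ι → ℤ) = Pi.single i 1 := by
  funext k
  by_cases h : k = i <;> simp [latticePoint, h]

theorem exists_matrix_of_integral {ι κ : Type*} [Fintype ι] [DecidableEq ι]
    (T : (ι → ℝ) × ℝ →ₗ[ℝ] (κ → ℝ) × ℝ)
    (hT : ∀ (z : ι → ℤ) (m : ℤ), ∃ z' : κ → ℤ, (T (latticePoint z, (m : ℝ))).1 = latticePoint z') :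
    ∃ (A : Matrix κ ι ℤ) (u : κ → ℤ), ∀ x c,
      (T (x, c)).1 = (A.map (Int.cast : ℤ → ℝ)).mulVec x + c • latticePoint u := by
  choose F hF using hT
  refine ⟨Matrix.of fun k i => F (Pi.single i 1) 0 k, F 0 1, fun x c => ?_⟩
  have hx : ((x, c) : (ι → ℝ) × ℝ) = ∑ i, x i • ((Pi.single i 1 : ι → ℝ), (0 : ℝ)) +
      c • ((0 : ι → ℝ), (1 : ℝ)) := by
    refine Prod.ext (funext fun k => ?_) ?_
    · simp [Prod.fst_sum, Pi.single_apply]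
    · simp [Prod.snd_sum]
  have h1 : ∀ i, (T ((Pi.single i 1 : ι → ℝ), (0 : ℝ))).1 = latticePoint (F (Pi.single i 1) 0) := by
    intro i
    rw [← hF, latticePoint_single, Int.cast_zero]
  have h2 : (T ((0 : ι → ℝ), (1 : ℝ))).1 = latticePoint (F 0 1) := by
    rw [← hF, Int.cast_one]
    congr 3
    simp [latticePoint, funext_iff]
  rw [hx, map_add, map_sum, Prod.fst_add, Prod.fst_sum]
  simp only [map_smul, Prod.smul_fst, h1, h2]
  congr 1
  funext k
  simp [Matrix.mulVec, dotProduct, latticePoint, mul_comm]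

theorem image_convexHull_mulVec_add {ι κ J : Type*} [Fintype ι] (A : Matrix κ ι ℝ) (u : κ → ℝ)
    (p : J → ι → ℝ) :
    (fun x => A.mulVec x + u) '' convexHull ℝ (Set.range p) =
      convexHull ℝ (Set.range fun j => A.mulVec (p j) + u) := by
  have := AffineMap.image_convexHull (A.mulVecLin.toAffineMap + AffineMap.const ℝ (ι → ℝ) u)
    (Set.range p)
  rw [← Set.range_comp] at this
  exact this

/-- Equal groups mean that the change of barycentric coordinates carries lattice points to lattice
points, so it is given by integers. It preserves the last component, which is the sum of the
coefficients on both sides. -/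
theorem IsLatticeSimplexWithVertices.exists_matrix {ι κ J : Type*} [Fintype ι]
    [Fintype κ] [DecidableEq ι] [Fintype J] {v : J → ι → ℤ} {w : J → κ → ℤ}
    {P : Set (ι → ℝ)} {Q : Set (κ → ℝ)} (hP : IsLatticeSimplexWithVertices v P)
    (hQ : IsLatticeSimplexWithVertices w Q) (h : simplexGroup v = simplexGroup w) :
    ∃ (A : Matrix κ ι ℤ) (u : κ → ℤ), ∀ x c,
      hQ.homogeneousEquiv (hP.homogeneousEquiv.symm (x, c)) =
        ((A.map (Int.cast : ℤ → ℝ)).mulVec x + c • latticePoint u, c) := by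
  obtain ⟨A, u, hA⟩ := exists_matrix_of_integral
    (hP.homogeneousEquiv.symm ≪≫ₗ hQ.homogeneousEquiv).toLinearMap fun z m => by
      obtain ⟨z', m', hz⟩ := (coe_mem_simplexGroup w _).1 (h ▸ hP.coe_symm_mem_simplexGroup z m)
      exact ⟨z', congrArg Prod.fst hz⟩
  refine ⟨A, u, fun x c => Prod.ext (hA x c) ?_⟩
  have h1 := congrArg Prod.snd (hP.homogeneousEquiv.apply_symm_apply (x, c))
  rw [hP.homogeneousEquiv_apply, homogenization_snd] at h1
  rw [hQ.homogeneousEquiv_apply, homogenization_snd, h1]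

theorem Matrix.mul_eq_one_of_mulVec {ι κ : Type*} [Fintype ι] [Fintype κ] [DecidableEq ι]
    [DecidableEq κ] (A : Matrix κ ι ℤ) (A' : Matrix ι κ ℤ)
    (h : ∀ x, (A'.map (Int.cast : ℤ → ℝ)).mulVec ((A.map (Int.cast : ℤ → ℝ)).mulVec x) = x) :
    A' * A = 1 := by
  have h1 : (A' * A).map (Int.castRingHom ℝ) = (1 : Matrix ι ι ℤ).map (Int.castRingHom ℝ) := by
    rw [Matrix.map_mul, Matrix.map_one _ (map_zero _) (map_one _)]
    refine Matrix.toLin'.injective (LinearMap.ext fun x => ?_)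
    rw [Matrix.toLin'_mul, Matrix.toLin'_one]
    exact h x
  exact Matrix.map_injective (RingHom.injective_int (Int.castRingHom ℝ)) h1

/-- Lattice simplices with the same group are unimodularly equivalent. -/
theorem IsLatticeSimplexWithVertices.unimodularlyEquivalent {ι κ J : Type*} [Fintype ι]
    [Fintype κ] [DecidableEq ι] [DecidableEq κ] [Fintype J] {v : J → ι → ℤ} {w : J → κ → ℤ}
    {P : Set (ι → ℝ)} {Q : Set (κ → ℝ)} (hP : IsLatticeSimplexWithVertices v P)
    (hQ : IsLatticeSimplexWithVertices w Q) (h : simplexGroup v = simplexGroup w) :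
    UnimodularlyEquivalent P Q := by
  classical
  obtain ⟨A, u, hA⟩ := hP.exists_matrix hQ h
  obtain ⟨A', u', hA'⟩ := hQ.exists_matrix hP h.symm
  refine ⟨A, A', u, ?_, ?_, ?_⟩
  · refine Matrix.mul_eq_one_of_mulVec A' A fun x => ?_
    -- Level c = 0 isolates the linear part; level c = 1, used for the vertices, includes the
    -- translation.
    have h1 := hA' x 0
    rw [zero_smul, add_zero] at h1
    have h2 := hA ((A'.map (Int.cast : ℤ → ℝ)).mulVec x) 0
    rw [zero_smul, add_zero, ← h1] at h2
    simpa using (congrArg Prod.fst h2).symm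
  · refine Matrix.mul_eq_one_of_mulVec A A' fun x => ?_
    have h1 := hA x 0
    rw [zero_smul, add_zero] at h1
    have h2 := hA' ((A.map (Int.cast : ℤ → ℝ)).mulVec x) 0
    rw [zero_smul, add_zero, ← h1] at h2
    simpa using (congrArg Prod.fst h2).symm
  · have hv : ∀ j, (A.map (Int.cast : ℤ → ℝ)).mulVec (latticePoint (v j)) + latticePoint u =
        latticePoint (w j) := by
      intro j
      have h1 := hA (latticePoint (v j)) 1
      rw [← homogenization_single v j, ← hP.homogeneousEquiv_apply, LinearEquiv.symm_apply_apply,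
        hQ.homogeneousEquiv_apply, homogenization_single, one_smul] at h1
      exact (congrArg Prod.fst h1).symm
    rw [hP.eq_convexHull, image_convexHull_mulVec_add, hQ.eq_convexHull]
    simp only [hv]

/-! ### Lattice pyramids. -/

theorem image_snoc_zero_convexHull {n : ℕ} {J : Type*} (p : J → Fin n → ℝ) :
    (fun a => (Fin.snoc a 0 : Fin (n + 1) → ℝ)) '' convexHull ℝ (Set.range p) =
      convexHull ℝ (Set.range fun j => (Fin.snoc (p j) 0 : Fin (n + 1) → ℝ)) := by
  let f : (Fin n → ℝ) →ₗ[ℝ] (Fin (n + 1) → ℝ) :=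
    { toFun := fun a => Fin.snoc a 0
      map_add' := fun a b => by
        funext i
        refine Fin.lastCases ?_ (fun i => ?_) i <;> simp
      map_smul' := fun c a => by
        funext i
        refine Fin.lastCases ?_ (fun i => ?_) i <;> simp }
  have := LinearMap.image_convexHull f (Set.range p)
  rw [← Set.range_comp] at this
  exact this

/-- A lattice simplex one of whose barycentric coordinates is integral on the lattice is a lattice
pyramid. -/
theorem IsLatticeSimplexWithVertices.isLatticePyramid {ι J : Type*} [Fintype ι] [DecidableEq ι]
    [Fintype J] {v : J → ι → ℤ} {P : Set (ι → ℝ)} (hP : IsLatticeSimplexWithVertices v P)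
    (j j₀ : J) (hj : j₀ ≠ j) (h : ∀ x ∈ simplexGroup v, x j = 0) : IsLatticePyramid P := by
  classical
  have hint : ∀ z : ι → ℤ, ∃ a : ℤ,
      hP.homogeneousEquiv.symm (latticePoint z, 0) j = a := by
    intro z
    have h1 := h _ (hP.coe_symm_mem_simplexGroup z 0)
    obtain ⟨a, ha⟩ := (AddCircle.coe_eq_zero_iff _).1 h1
    exact ⟨a, by simpa [eq_comm] using ha⟩
  choose a ha using hint
  have hadd : ∀ z z', latticePoint (z + z' : ι → ℤ) = latticePoint z + latticePoint z' := by
    intro z z'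
    funext i
    simp [latticePoint]
  -- The integral j-th barycentric coordinate on differences: it vanishes along the facet opposite
  -- `v j` and equals 1 on `v j - v j₀`.
  let α : (ι → ℤ) →ₗ[ℤ] ℤ := (AddMonoidHom.mk' a fun z z' => by
    have h1 : ((latticePoint (z + z'), 0) : (ι → ℝ) × ℝ) =
        (latticePoint z, 0) + (latticePoint z', 0) := by simp [hadd]
    have h2 := ha (z + z')
    rw [h1, map_add, Pi.add_apply, ha, ha] at h2
    exact_mod_cast h2.symm).toIntLinearMap
  have hα : ∀ i, α (v i - v j₀) = (Pi.single i 1 : J → ℤ) j := by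
    intro i
    have h1 : ((latticePoint (v i - v j₀), 0) : (ι → ℝ) × ℝ) =
        hP.homogeneousEquiv (Pi.single i 1 - Pi.single j₀ 1) := by
      rw [map_sub, hP.homogeneousEquiv_apply, hP.homogeneousEquiv_apply, homogenization_single,
        homogenization_single]
      refine Prod.ext (funext fun k => ?_) ?_ <;> simp [latticePoint]
    have h2 := ha (v i - v j₀)
    rw [h1, LinearEquiv.symm_apply_apply] at h2
    have h3 : ((Pi.single i 1 : J → ℤ) j : ℝ) = (Pi.single i 1 : J → ℝ) j := by
      by_cases hi : j = i <;> simp [hi]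
    have h4 : (a (v i - v j₀) : ℝ) = (Pi.single i 1 : J → ℤ) j := by
      rw [← h2, h3]
      simp [hj.symm]
    exact_mod_cast h4
  -- Since α takes the value 1 on `v j - v j₀`, this vector completes a basis of ker α to a basis of
  -- ℤ^ι. With `v j₀` as origin, the facet then has last coordinate 0 and the apex is (0, …, 0, 1).
  obtain ⟨n, b₀⟩ := Submodule.basisOfPid (Pi.basisFun ℤ ι) (LinearMap.ker α)
  have hy : α (v j - v j₀) = 1 := by simp [hα]
  let b := Module.Basis.mkFinSnoc b₀ (v j - v j₀)
    (fun c x hx hc => by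
      have := congrArg α hc
      rw [map_add, map_smul, hy, LinearMap.mem_ker.1 hx] at this
      simpa using this)
    (fun z => ⟨-α z, by rw [LinearMap.mem_ker, map_add, map_smul, hy]; simp⟩)
  have hb : ⇑b = Fin.snoc ((↑) ∘ b₀) (v j - v j₀) := Module.Basis.coe_mkFinSnoc ..
  have hlast : ∀ z, b.equivFun z (Fin.last n) = α z := by
    intro z
    conv_rhs => rw [← b.sum_equivFun z, Fin.sum_univ_castSucc]
    rw [map_add, map_sum, map_smul, show b (Fin.last n) = v j - v j₀ by simp [hb], hy,
      Finset.sum_eq_zero]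
    · simp
    · intro l _
      rw [map_smul, show b l.castSucc = b₀ l by simp [hb], LinearMap.mem_ker.1 (b₀ l).2, smul_zero]
  have hapex : b.equivFun (v j - v j₀) = Fin.snoc 0 1 := by
    have : v j - v j₀ = b (Fin.last n) := by simp [hb]
    rw [this]
    funext i
    rw [b.equivFun_self]
    refine Fin.lastCases ?_ (fun i => ?_) i
    · simp
    · simp [(Fin.castSucc_ne_last i).symm]
  set A := LinearMap.toMatrix' b.equivFun.toLinearMap with hA
  set A' := LinearMap.toMatrix' b.equivFun.symm.toLinearMap with hA'
  have hmulVec : ∀ z, A.mulVec z = b.equivFun z := fun z => by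
    rw [hA, LinearMap.toMatrix'_mulVec]
    rfl
  have hcast : ∀ z, (A.map (Int.cast : ℤ → ℝ)).mulVec (latticePoint z) =
      latticePoint (A.mulVec z) := by
    intro z
    funext k
    simp [Matrix.mulVec, dotProduct, latticePoint]
  set V : J → Fin n → ℤ := fun i => Fin.init (b.equivFun (v i - v j₀)) with hV
  refine ⟨n, convexHull ℝ (Set.range fun i : {i // i ≠ j} => latticePoint (V i)),
    ⟨Finset.univ.image fun i : {i // i ≠ j} => V i, ⟨V j₀, ?_⟩, ?_⟩,
    A, A', -A.mulVec (v j₀), ?_, ?_, ?_⟩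
  · exact Finset.mem_image.2 ⟨⟨j₀, hj⟩, Finset.mem_univ _, rfl⟩
  · rw [Finset.coe_image, Finset.coe_univ, Set.image_univ, ← Set.range_comp]
    rfl
  · rw [hA, hA', ← LinearMap.toMatrix'_comp]
    simp
  · rw [hA, hA', ← LinearMap.toMatrix'_comp]
    simp
  · have himg : ∀ i, (A.map (Int.cast : ℤ → ℝ)).mulVec (latticePoint (v i)) +
        latticePoint (-A.mulVec (v j₀)) = latticePoint (b.equivFun (v i - v j₀)) := by
      intro i
      rw [hcast, ← hmulVec, Matrix.mulVec_sub]
      funext k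
      simp [latticePoint, sub_eq_add_neg]
    have hfacet : ∀ i : {i // i ≠ j}, (Fin.snoc (latticePoint (V i)) 0 : Fin (n + 1) → ℝ) =
        latticePoint (b.equivFun (v i - v j₀)) := by
      intro i
      have h0 : b.equivFun (v i - v j₀) (Fin.last n) = 0 := by
        rw [hlast, hα]
        simp [i.2.symm]
      funext k
      refine Fin.lastCases ?_ (fun k => ?_) k
      · simp [latticePoint, h0, -Module.Basis.equivFun_apply]
      · simp [latticePoint, hV, Fin.init]
    have hapex' : (Fin.snoc (0 : Fin n → ℝ) 1 : Fin (n + 1) → ℝ) =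
        latticePoint (b.equivFun (v j - v j₀)) := by
      rw [hapex]
      funext k
      refine Fin.lastCases ?_ (fun k => ?_) k <;> simp [latticePoint]
    rw [hP.eq_convexHull, image_convexHull_mulVec_add, latticePyr, image_snoc_zero_convexHull,
      convexHull_convexHull_union_left, hapex']
    simp only [hfacet, himg]
    congr 1
    ext x
    simp only [Set.mem_union, Set.mem_range, Set.mem_singleton_iff, Subtype.exists]
    constructor
    · rintro (⟨i, -, rfl⟩ | rfl)
      · exact ⟨i, rfl⟩
      · exact ⟨j, rfl⟩
    · rintro ⟨i, rfl⟩
      by_cases hi : i = j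
      · exact Or.inr (by rw [hi])
      · exact Or.inl ⟨i, hi, rfl⟩

/-! ### Fractional parts and heights. -/

/-- The representative in `[0, 1)` of an element of `ℝ/ℤ`. -/
noncomputable def UnitAddCircle.frac (a : UnitAddCircle) : ℝ := (AddCircle.equivIco 1 0 a : ℝ)

theorem UnitAddCircle.frac_nonneg (a : UnitAddCircle) : 0 ≤ a.frac :=
  (AddCircle.equivIco 1 0 a).2.1

theorem UnitAddCircle.frac_lt_one (a : UnitAddCircle) : a.frac < 1 :=
  (AddCircle.equivIco 1 0 a).2.2.trans_eq (zero_add 1)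

theorem UnitAddCircle.coe_frac (a : UnitAddCircle) : (a.frac : UnitAddCircle) = a :=
  AddCircle.coe_equivIco

theorem UnitAddCircle.frac_coe (r : ℝ) : UnitAddCircle.frac (r : UnitAddCircle) = Int.fract r := by
  have := AddCircle.coe_equivIco_mk_apply (1 : ℝ) r
  rwa [div_one, mul_one] at this

theorem UnitAddCircle.frac_add_frac_neg (a : UnitAddCircle) [Decidable (a ≠ 0)] :
    a.frac + (-a).frac = if a ≠ 0 then 1 else 0 := by
  split_ifs with h
  · have h1 : Int.fract a.frac = a.frac :=
      Int.fract_eq_self.2 ⟨a.frac_nonneg, a.frac_lt_one⟩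
    have h2 : Int.fract a.frac ≠ 0 := by
      rw [h1]
      intro h0
      exact h (by rw [← a.coe_frac, h0, AddCircle.coe_zero])
    conv_lhs => rw [← a.coe_frac, ← AddCircle.coe_neg, frac_coe, frac_coe, Int.fract_neg h2]
    ring
  · have h0 : UnitAddCircle.frac 0 = 0 := by
      rw [← AddCircle.coe_zero, frac_coe, Int.fract_zero]
    rw [not_not.1 h, neg_zero, h0, add_zero]

/-- The sum of the coordinates of a point of `(ℝ/ℤ)^J`, represented in `[0, 1)`, rounded down. On
the group of a lattice simplex that sum is an integer. -/
noncomputable def torusHeight {J : Type*} [Fintype J] (x : J → UnitAddCircle) : ℕ :=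
  ⌊∑ j, (x j).frac⌋₊

theorem exists_homogenization_frac {ι J : Type*} [Fintype J] {v : J → ι → ℤ}
    {x : J → UnitAddCircle} (hx : x ∈ simplexGroup v) :
    ∃ z : ι → ℤ, homogenization v (fun j => (x j).frac) = (latticePoint z, (torusHeight x : ℝ)) := by
  obtain ⟨z, m, h⟩ := (coe_mem_simplexGroup v fun j => (x j).frac).1
    (by simpa only [UnitAddCircle.coe_frac] using hx)
  refine ⟨z, h.trans (Prod.ext rfl ?_)⟩
  have h1 := congrArg Prod.snd h
  rw [homogenization_snd] at h1
  have hm : 0 ≤ m := by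
    have : (0 : ℝ) ≤ m := h1.le.trans' (Finset.sum_nonneg fun j _ => (x j).frac_nonneg)
    exact_mod_cast this
  lift m to ℕ using hm
  simp only [Int.cast_natCast] at h1
  simp [torusHeight, h1]

theorem sum_frac_eq_torusHeight {ι J : Type*} [Fintype J] {v : J → ι → ℤ}
    {x : J → UnitAddCircle} (hx : x ∈ simplexGroup v) : ∑ j, (x j).frac = torusHeight x := by
  obtain ⟨z, hz⟩ := exists_homogenization_frac hx
  rw [← homogenization_snd v, hz]

/-- Links the degree to the code weight: the representatives of a and -a add up to 1 unless a = 0.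
-/
theorem ncard_support_eq_torusHeight_add {ι J : Type*} [Fintype J] {v : J → ι → ℤ}
    {x : J → UnitAddCircle} (hx : x ∈ simplexGroup v) :
    Set.ncard {j | x j ≠ 0} = torusHeight x + torusHeight (-x) := by
  classical
  have h1 : (Set.ncard {j | x j ≠ 0} : ℝ) = torusHeight x + torusHeight (-x) := by
    rw [← sum_frac_eq_torusHeight hx, ← sum_frac_eq_torusHeight (neg_mem hx),
      ← Finset.sum_add_distrib]
    simp only [Pi.neg_apply, UnitAddCircle.frac_add_frac_neg]
    exact_mod_cast Set.natCast_ncard_setOf fun j => x j ≠ 0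
  exact_mod_cast h1

/-! ### Ehrhart series and the group Λ. -/

theorem IsLatticeSimplexWithVertices.mem_smul_iff {ι J : Type*} [Fintype ι] [Fintype J]
    {v : J → ι → ℤ} {P : Set (ι → ℝ)} (hP : IsLatticeSimplexWithVertices v P) (n : ℕ)
    (x : ι → ℝ) :
    x ∈ (n : ℝ) • P ↔ ∃ f : J → ℝ, (∀ j, 0 ≤ f j) ∧ homogenization v f = (x, (n : ℝ)) := by
  classical
  have himg : P = (fun f => (homogenization v f).1) '' stdSimplex ℝ J := by
    have h1 := LinearMap.image_convexHull (LinearMap.fst ℝ (ι → ℝ) ℝ ∘ₗ homogenization v)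
      (Set.range fun j : J => (Pi.single j 1 : J → ℝ))
    rw [convexHull_rangle_single_eq_stdSimplex, ← Set.range_comp] at h1
    rw [hP.eq_convexHull]
    refine Eq.trans ?_ h1.symm
    congr 2
    funext j
    simp [homogenization_single]
  constructor
  · rintro ⟨y, hy, rfl⟩
    rw [himg] at hy
    obtain ⟨f, hf, rfl⟩ := hy
    refine ⟨(n : ℝ) • f, fun j => mul_nonneg n.cast_nonneg (hf.1 j), ?_⟩
    rw [map_smul]
    refine Prod.ext rfl ?_
    rw [Prod.smul_snd, homogenization_snd, hf.2, smul_eq_mul, mul_one]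
  · rintro ⟨f, hf, hfx⟩
    have hsum : ∑ j, f j = n := by rw [← homogenization_snd v, hfx]
    have hx : x = (homogenization v f).1 := by rw [hfx]
    -- The dilate by 0 cannot be rescaled; it is {0} because P has a vertex.
    rcases Nat.eq_zero_or_pos n with rfl | hn
    · have h0 : f = 0 := by
        funext j
        rw [Nat.cast_zero, Finset.sum_eq_zero_iff_of_nonneg fun j _ => hf j] at hsum
        exact hsum j (Finset.mem_univ j)
      have : Nonempty J := Fintype.card_pos_iff.1 (by rw [hP.card_eq]; omega)
      obtain ⟨j⟩ := this
      refine ⟨latticePoint (v j), ?_, ?_⟩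
      · rw [hP.eq_convexHull]
        exact subset_convexHull ℝ _ ⟨j, rfl⟩
      · simp [hx, h0]
    · have hn' : (n : ℝ) ≠ 0 := by positivity
      refine ⟨(homogenization v ((n : ℝ)⁻¹ • f)).1, ?_, ?_⟩
      · rw [himg]
        refine ⟨_, ⟨fun j => mul_nonneg (by positivity) (hf j), ?_⟩, rfl⟩
        simp only [← Finset.mul_sum, hsum]
        exact inv_mul_cancel₀ hn'
      · change (n : ℝ) • _ = x
        rw [map_smul, Prod.smul_fst, smul_smul, mul_inv_cancel₀ hn', one_smul, hx]

/-- Representatives in [0, 1) send Λ injectively to lattice points of a bounded box. -/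
theorem IsLatticeSimplexWithVertices.finite_simplexGroup {ι J : Type*} [Fintype ι] [Fintype J]
    {v : J → ι → ℤ} {P : Set (ι → ℝ)} (hP : IsLatticeSimplexWithVertices v P) :
    Finite (simplexGroup v) := by
  classical
  choose z hz using fun x : simplexGroup v => exists_homogenization_frac x.2
  let F : simplexGroup v → (ι → ℤ) × ℕ := fun x => (z x, torusHeight x.1)
  have hF : Function.Injective F := by
    intro x y hxy
    have h1 : homogenization v (fun j => (x.1 j).frac) =
        homogenization v (fun j => (y.1 j).frac) := by
      rw [hz, hz, show z x = z y from congrArg Prod.fst hxy,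
        show torusHeight x.1 = torusHeight y.1 from congrArg Prod.snd hxy]
    have h2 := hP.bijective_homogenization.1 h1
    refine Subtype.ext (funext fun j => ?_)
    rw [← (x.1 j).coe_frac, ← (y.1 j).coe_frac, congrFun h2 j]
  have hrange : Set.range F ⊆ Set.Icc (fun i => -∑ j, |v j i|, 0)
      (fun i => ∑ j, |v j i|, Fintype.card J) := by
    rintro _ ⟨x, rfl⟩
    have habs : ∀ i, |z x i| ≤ ∑ j, |v j i| := by
      intro i
      have h1 : ∑ j, (x.1 j).frac * v j i = z x i := by
        rw [← homogenization_fst, hz]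
        rfl
      have h2 : |(z x i : ℝ)| ≤ ∑ j, |(v j i : ℝ)| := by
        rw [← h1]
        refine (Finset.abs_sum_le_sum_abs _ _).trans (Finset.sum_le_sum fun j _ => ?_)
        rw [abs_mul, abs_of_nonneg (x.1 j).frac_nonneg]
        exact mul_le_of_le_one_left (abs_nonneg _) (x.1 j).frac_lt_one.le
      exact_mod_cast h2
    have hht : torusHeight x.1 ≤ Fintype.card J := by
      refine Nat.floor_le_of_le ?_
      refine (Finset.sum_le_sum fun j _ => (x.1 j).frac_lt_one.le).trans ?_
      simp
    exact ⟨⟨fun i => (abs_le.1 (habs i)).1, Nat.zero_le _⟩, ⟨fun i => (abs_le.1 (habs i)).2, hht⟩⟩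
  have : Finite (Set.range F) := (Set.finite_Icc _ _).subset hrange
  exact Finite.of_injective_finite_range hF

/-- A lattice point of nP has unique nonnegative coefficients with sum n. Their fractional parts
form an element x of Λ, and their integer parts are an arbitrary vector of naturals with sum n -
height(x). -/
theorem IsLatticeSimplexWithVertices.ehrhartCount_eq {ι J : Type*} [Fintype ι] [Fintype J]
    [DecidableEq J] {v : J → ι → ℤ} {P : Set (ι → ℝ)} (hP : IsLatticeSimplexWithVertices v P)
    [Fintype (simplexGroup v)] (n : ℕ) :
    ehrhartCount P n = ∑ x : simplexGroup v, if torusHeight x.1 ≤ n then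
      (Finset.univ.finsuppAntidiag (n - torusHeight x.1) : Finset (J →₀ ℕ)).card else 0 := by
  set T : Finset (Σ _ : simplexGroup v, J →₀ ℕ) := Finset.univ.sigma fun x =>
    if torusHeight x.1 ≤ n then Finset.univ.finsuppAntidiag (n - torusHeight x.1) else ∅ with hT
  have hmemT : ∀ q, q ∈ T ↔ torusHeight q.1.1 + ∑ j, q.2 j = n := by
    intro q
    simp only [hT, Finset.mem_sigma, Finset.mem_univ, true_and]
    split_ifs with h
    · simp only [Finset.mem_finsuppAntidiag, Finset.subset_univ, and_true]
      change ∑ j, q.2 j = _ ↔ _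
      omega
    · simp only [Finset.notMem_empty, false_iff]
      omega
  have hcardT : T.card = ∑ x : simplexGroup v, if torusHeight x.1 ≤ n then
      (Finset.univ.finsuppAntidiag (n - torusHeight x.1) : Finset (J →₀ ℕ)).card else 0 := by
    rw [hT, Finset.card_sigma]
    refine Finset.sum_congr rfl fun x _ => ?_
    split_ifs <;> rfl
  let f : (Σ _ : simplexGroup v, J →₀ ℕ) → J → ℝ := fun q j => (q.1.1 j).frac + q.2 j
  have hcoe : ∀ q j, (f q j : UnitAddCircle) = q.1.1 j := by
    intro q j
    have h0 : ((q.2 j : ℝ) : UnitAddCircle) = 0 :=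
      (AddCircle.coe_eq_zero_iff _).2 ⟨q.2 j, by simp⟩
    rw [AddCircle.coe_add, h0, add_zero, UnitAddCircle.coe_frac]
  have hf : ∀ q ∈ T, ∃ z : ι → ℤ, homogenization v (f q) = (latticePoint z, (n : ℝ)) := by
    intro q hq
    obtain ⟨z, m, h⟩ := (coe_mem_simplexGroup v (f q)).1 (by simp only [hcoe]; exact q.1.2)
    refine ⟨z, h.trans (Prod.ext rfl ?_)⟩
    rw [← congrArg Prod.snd h, homogenization_snd, Finset.sum_add_distrib,
      sum_frac_eq_torusHeight q.1.2, ← (hmemT q).1 hq]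
    push_cast
    rfl
  choose! z hz using hf
  have hlat : Function.Injective (latticePoint : (ι → ℤ) → ι → ℝ) :=
    fun a b hab => funext fun i => Int.cast_injective (congrFun hab i)
  have himage : {y : ι → ℤ | latticePoint y ∈ (n : ℝ) • P} = z '' T := by
    ext y
    simp only [Set.mem_ofPred_eq, hP.mem_smul_iff, Set.mem_image, Finset.mem_coe]
    constructor
    · rintro ⟨g, hg0, hg⟩
      have hmem : (fun j => (g j : UnitAddCircle)) ∈ simplexGroup v :=
        (coe_mem_simplexGroup v g).2 ⟨y, n, by simpa using hg⟩
      let q : Σ _ : simplexGroup v, J →₀ ℕ :=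
        ⟨⟨_, hmem⟩, Finsupp.equivFunOnFinite.symm fun j => ⌊g j⌋₊⟩
      have hfq : f q = g := by
        funext j
        change UnitAddCircle.frac (g j : UnitAddCircle) + (⌊g j⌋₊ : ℝ) = g j
        rw [UnitAddCircle.frac_coe, natCast_floor_eq_intCast_floor (hg0 j)]
        exact Int.fract_add_floor _
      have hq : q ∈ T := by
        rw [hmemT]
        have h1 : ∑ j, f q j = n := by rw [hfq, ← homogenization_snd v, hg]
        rw [Finset.sum_add_distrib, sum_frac_eq_torusHeight q.1.2] at h1
        exact_mod_cast h1
      refine ⟨q, hq, hlat ?_⟩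
      have := hz q hq
      rw [hfq, hg] at this
      exact (congrArg Prod.fst this).symm
    · rintro ⟨q, hq, rfl⟩
      exact ⟨f q, fun j => add_nonneg (q.1.1 j).frac_nonneg (Nat.cast_nonneg _), hz q hq⟩
  have hinj : Set.InjOn z T := by
    intro p hp q hq hpq
    have h1 : f p = f q := hP.bijective_homogenization.1 (by rw [hz p hp, hz q hq, hpq])
    have h2 : p.1 = q.1 := Subtype.ext (funext fun j => by rw [← hcoe, ← hcoe, h1])
    have h3 : p.2 = q.2 := by
      ext j
      have h4 := congrFun h1 j
      simp only [f, h2, add_right_inj, Nat.cast_inj] at h4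
      exact h4
    exact Sigma.ext h2 (heq_of_eq h3)
  rw [ehrhartCount, himage, hinj.ncard_image, Set.ncard_coe_finset, hcardT]

/-- The `h^*`-polynomial of a lattice simplex counts the elements of its group by height. -/
theorem IsLatticeSimplexWithVertices.ehrhartSeries_mul {ι J : Type*} [Fintype ι] [Fintype J]
    {v : J → ι → ℤ} {P : Set (ι → ℝ)} (hP : IsLatticeSimplexWithVertices v P)
    [Fintype (simplexGroup v)] :
    ehrhartSeries P * (1 - PowerSeries.X) ^ (Fintype.card ι + 1) =
      ∑ x : simplexGroup v, (PowerSeries.X : ℤ⟦X⟧) ^ torusHeight x.1 := by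
  classical
  -- The integer parts contribute one geometric series for each vertex.
  have h1 : ehrhartSeries P = ∑ x : simplexGroup v,
      (PowerSeries.X : ℤ⟦X⟧) ^ torusHeight x.1 * ∏ _j : J, PowerSeries.mk 1 := by
    ext n
    rw [ehrhartSeries, PowerSeries.coeff_mk, hP.ehrhartCount_eq, map_sum, Nat.cast_sum]
    refine Finset.sum_congr rfl fun x _ => ?_
    rw [PowerSeries.coeff_X_pow_mul', PowerSeries.coeff_prod]
    split_ifs <;> simp
  rw [h1, Finset.sum_mul]
  refine Finset.sum_congr rfl fun x _ => ?_
  rw [Finset.prod_const, Finset.card_univ, ← hP.card_eq, mul_assoc, ← mul_pow,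
    PowerSeries.mk_one_mul_one_sub_eq_one, one_pow, mul_one]

/-- The coefficients of `h^*` count elements of Λ, so nothing cancels and every height that occurs
is an exponent of `h^*`. -/
theorem IsLatticeSimplexWithVertices.torusHeight_le {ι J : Type*} [Fintype ι] [Fintype J]
    {v : J → ι → ℤ} {P : Set (ι → ℝ)} (hP : IsLatticeSimplexWithVertices v P) {s : ℕ}
    (hs : HasHStarDegree P s) {x : J → UnitAddCircle} (hx : x ∈ simplexGroup v) :
    torusHeight x ≤ s := by
  have := hP.finite_simplexGroup
  have := Fintype.ofFinite (simplexGroup v)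
  obtain ⟨h, hh, hdeg⟩ := hs
  have h1 : (h : ℤ⟦X⟧) = ∑ x : simplexGroup v, (PowerSeries.X : ℤ⟦X⟧) ^ torusHeight x.1 :=
    hh.trans hP.ehrhartSeries_mul
  have h2 : h.coeff (torusHeight x) ≠ 0 := by
    rw [← Polynomial.coeff_coe, h1, map_sum]
    simp only [PowerSeries.coeff_X_pow]
    refine (Finset.sum_pos' (fun y _ => by split_ifs <;> simp) ⟨⟨x, hx⟩, Finset.mem_univ _, ?_⟩).ne'
    simp
  have h3 := Polynomial.le_degree_of_ne_zero h2
  rw [hdeg] at h3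
  exact_mod_cast h3

/-! ### Relabelling of the vertices and conclusion. -/

theorem mem_simplexGroup_comp {ι J K : Type*} [Fintype J] [Fintype K] (v : J → ι → ℤ)
    (e : K ≃ J) (x : J → UnitAddCircle) :
    x ∘ e ∈ simplexGroup (v ∘ e) ↔ x ∈ simplexGroup v := by
  change ((∀ i, ∑ k, v (e k) i • x (e k) = 0) ∧ ∑ k, x (e k) = 0) ↔
    (∀ i, ∑ j, v j i • x j = 0) ∧ ∑ j, x j = 0
  simp only [e.sum_comp fun j => x j, fun i => e.sum_comp fun j => v j i • x j]

theorem theorem1p2 (s : ℕ) (hs : 0 < s) (Δ : Set (Fin (4 * s - 2) → ℝ))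
    (hΔ : IsLatticeSimplex Δ) (hdeg : HasHStarDegree Δ s) (hpyr : ¬ IsLatticePyramid Δ) :
    ∃ r : ℕ, s = 2 ^ r ∧ ArisesFromSimplexCode (r + 2) Δ ∧
      UnimodularlyEquivalent Δ (codeSimplex (r + 2)) := by
  obtain ⟨v, hv⟩ := hΔ
  -- Positivity of s makes the truncated subtraction 4s - 2 exact, so there are 4s - 1 vertices.
  have hcard : Fintype.card (Fin (Fintype.card (Fin (4 * s - 2)) + 1)) + 1 = 4 * s := by
    simp only [Fintype.card_fin]
    omega
  have hfin := hv.finite_simplexGroup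
  obtain ⟨r, e, hr, he⟩ := AddSubgroup.exists_equiv_binaryPoint hcard (simplexGroup v)
    (by
      intro j
      by_contra! h
      have : Nontrivial (Fin (Fintype.card (Fin (4 * s - 2)) + 1)) :=
        Fintype.one_lt_card_iff_nontrivial.1 (by omega)
      obtain ⟨j₀, hj₀⟩ := exists_ne j
      exact hpyr (hv.isLatticePyramid j j₀ hj₀ h))
    (by
      intro x hx
      rw [ncard_support_eq_torusHeight_add hx]
      have h1 := hv.torusHeight_le hdeg hx
      have h2 := hv.torusHeight_le hdeg (neg_mem hx)
      omega)
  have hve : IsLatticeSimplexWithVertices (v ∘ e) Δ :=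
    ⟨by rw [Fintype.card_congr e, hv.card_eq],
      hv.affineIndependent.comp_embedding e.toEmbedding, by
        rw [hv.eq_convexHull, ← e.surjective.range_comp]
        rfl⟩
  have hgroup : simplexGroup (v ∘ e) = codeGroup (binarySimplexCode (r + 2)) := by
    ext y
    have hy : y = (y ∘ e.symm) ∘ e := by
      rw [Function.comp_assoc, e.symm_comp_self, Function.comp_id]
    rw [hy, mem_simplexGroup_comp, he]
  obtain ⟨w, hw, hwgroup⟩ := codeSimplex_spec (r + 2) (by omega)
  exact ⟨r, hr, ⟨v ∘ e, hve, hgroup⟩, hve.unimodularlyEquivalent hw (hgroup.trans hwgroup.symm)⟩
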